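/- Let $d,k$ be natural numbers. A maximally entangled state in $\mathbb{C}^d\otimes\mathbb{C}^d$ is a vector $(U\otimes I)|\Gamma\rangle$ with $U$ unitary and $|\Gamma\rangle=\frac{1}{\sqrt d}\sum_{j=1}^d|jj\rangle$; two such states are orthogonal iff the corresponding unitaries are Hilbert–Schmidt orthogonal. For a set $\mathcal S=\{|\psi_1\rangle,\dots,|\psi_n\rangle\}$ of orthonormal states in $\mathbb{C}^d\otimes\mathbb{C}^d$ and a $k$-element set $T\subseteq\{1,\dots,n\}$, let $$\rho_T=\frac{1}{k!}\sum_{\sigma}|\Psi_\sigma\rangle\langle\Psi_\sigma|,\qquad |\Psi_\sigma\rangle=|\psi_{\sigma(1)}\rangle\otimes\cdots\otimes|\psi_{\sigma(k)}\rangle,$$ where $\sigma$ runs over the $k!$ bijections $\{1,\dots,k\}\to T$, regarded as a bipartite state in which one party holds the first tensor factors and the other party the second tensor factors of all $k$ states. The set $\mathcal S$ is called $(n,k)$-identifiable if there is a measurement $(M_T)_{|T|=k}$ with $\operatorname{Tr}(M_T\rho_T)=1$ for all $T$ that the two parties can implement by local operations and classical communication (LOCC), where finite-round LOCC protocols as well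 as limits of the measurements implemented by such protocols are allowed; otherwise $\mathcal S$ is called $(n,k)$-unidentifiable. (1) If $\mathcal S$ is an orthonormal basis of $\mathbb{C}^d\otimes\mathbb{C}^d$ consisting of $d^2$ maximally entangled states and $\binom{d^2}{k}>d^k$, then $\mathcal S$ is $(d^2,k)$-unidentifiable. (2) More generally, if $\mathcal S$ is any set of $D$ pairwise orthogonal maximally entangled states in $\mathbb{C}^d\otimes\mathbb{C}^d$ and $\binom{D}{k}>d^k$, then $\mathcal S$ is $(D,k)$-unidentifiable. -/

import Mathlib

open scoped Kronecker

namespace LocalSubset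

/-- Measurements on `ℂ^A ⊗ ℂ^B` (families of effects `M i`, one for each answer `i : κ`) that two
parties can perform by a finite protocol of local operations and classical communication.

A protocol either stops with an answer, or one of the parties performs a local quantum operation
with Kraus operators `K x` (`∑ x, K x ᴴ * K x = 1`) from its system to a system of arbitrary
dimension `n x`, tells the result `x` to the other party, and they go on with a protocol that
may depend on `x`. The effects are those of the whole protocol, pulled back to the initial system.
Local ancillas, local randomness and operations with several Kraus operators per message
are included: the continuation is free to ignore (part of) `x`. -/
inductive IsFiniteLOCC {κ : Type} [DecidableEq κ] :
    ∀ {A B : Type}, (κ → Matrix (A × B) (A × B) ℂ) → Prop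
  | halt {A B : Type} [DecidableEq A] [DecidableEq B] (answer : κ) :
      IsFiniteLOCC (fun i => if i = answer then (1 : Matrix (A × B) (A × B) ℂ) else 0)
  | alice {A B : Type} [Fintype A] [DecidableEq A] [Fintype B] [DecidableEq B]
      {r : ℕ} {n : Fin r → ℕ} (K : ∀ x, Matrix (Fin (n x)) A ℂ)
      (hK : ∑ x, (K x).conjTranspose * K x = 1)
      (M : ∀ x, κ → Matrix (Fin (n x) × B) (Fin (n x) × B) ℂ)
      (hM : ∀ x, IsFiniteLOCC (M x)) :
      IsFiniteLOCC (fun i => ∑ x,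
        (K x ⊗ₖ (1 : Matrix B B ℂ)).conjTranspose * M x i * (K x ⊗ₖ (1 : Matrix B B ℂ)))
  | bob {A B : Type} [Fintype A] [DecidableEq A] [Fintype B] [DecidableEq B]
      {r : ℕ} {n : Fin r → ℕ} (K : ∀ x, Matrix (Fin (n x)) B ℂ)
      (hK : ∑ x, (K x).conjTranspose * K x = 1)
      (M : ∀ x, κ → Matrix (A × Fin (n x)) (A × Fin (n x)) ℂ)
      (hM : ∀ x, IsFiniteLOCC (M x)) :
      IsFiniteLOCC (fun i => ∑ x,
        ((1 : Matrix A A ℂ) ⊗ₖ K x).conjTranspose * M x i * ((1 : Matrix A A ℂ) ⊗ₖ K x))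

/-- LOCC measurements, in the widest sense: finite LOCC protocols together with all limits of them.
This contains in particular the protocols with an unbounded number of rounds or with
countably many messages. -/
def IsLOCC {κ A B : Type} [DecidableEq κ] (M : κ → Matrix (A × B) (A × B) ℂ) : Prop :=
  M ∈ closure {M' : κ → Matrix (A × B) (A × B) ℂ | IsFiniteLOCC M'}

/-- A family of mixed states of `ℂ^A ⊗ ℂ^B` is perfectly distinguishable by LOCC: some LOCC
measurement gives the answer `i` with probability one on the state `ρ i`, for all `i`. -/
def IsLocallyDistinguishable {κ A B : Type} [DecidableEq κ] [Fintype A] [Fintype B]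
    (ρ : κ → Matrix (A × B) (A × B) ℂ) : Prop :=
  ∃ M : κ → Matrix (A × B) (A × B) ℂ, IsLOCC M ∧ ∀ i, (M i * ρ i).trace = 1

/-- The product `ψ (f 0) ⊗ ⋯ ⊗ ψ (f (k-1))` of bipartite states, as a bipartite state: the first
party holds the first factor of each of the `k` states, the second party the second factors. -/
noncomputable def tupleState {ι A B : Type} {k : ℕ} (ψ : ι → EuclideanSpace ℂ (A × B))
    (f : Fin k → ι) : (Fin k → A) × (Fin k → B) → ℂ :=
  fun p => ∏ j, ψ (f j) (p.1 j, p.2 j)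

/-- The mixed state shared by the parties if the states `ψ i`, `i ∈ T`, are distributed in a
uniformly random order, where `T` has `k` elements. -/
noncomputable def subsetState {ι A B : Type} [DecidableEq ι] {k : ℕ}
    (ψ : ι → EuclideanSpace ℂ (A × B)) (T : {T : Finset ι // T.card = k}) :
    Matrix ((Fin k → A) × (Fin k → B)) ((Fin k → A) × (Fin k → B)) ℂ :=
  ((k.factorial : ℂ)⁻¹) • ∑ σ : Fin k ≃ {i // i ∈ T.1},
    Matrix.vecMulVec (tupleState ψ (fun j => (σ j).1)) (star (tupleState ψ (fun j => (σ j).1)))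

/-- `(n, k)`-identifiability of a family of `n` bipartite states `ψ`: the `k`-element subsets can be
perfectly identified (without the order of their elements) by LOCC. -/
def IsLocallyIdentifiable {ι A B : Type} [DecidableEq ι] [Fintype A] [Fintype B]
    (ψ : ι → EuclideanSpace ℂ (A × B)) (k : ℕ) : Prop :=
  IsLocallyDistinguishable (fun T : {T : Finset ι // T.card = k} => subsetState ψ T)

/-- `(n, k)`-unidentifiability. -/
def IsLocallyUnidentifiable {ι A B : Type} [DecidableEq ι] [Fintype A] [Fintype B]
    (ψ : ι → EuclideanSpace ℂ (A × B)) (k : ℕ) : Prop :=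
  ¬ IsLocallyIdentifiable ψ k

/-- The vector `(1/√d) ∑ j, |j j⟩` of `ℂ^d ⊗ ℂ^d`. -/
noncomputable def Gam (d : ℕ) : Fin d × Fin d → ℂ :=
  fun p => if p.1 = p.2 then ((Real.sqrt d : ℝ) : ℂ)⁻¹ else 0

/-- Maximally entangled states of `ℂ^d ⊗ ℂ^d`: the vectors `(U ⊗ 1) Γ` with `U` unitary. -/
def IsMaximallyEntangled {d : ℕ} (ψ : EuclideanSpace ℂ (Fin d × Fin d)) : Prop :=
  ∃ U ∈ Matrix.unitaryGroup (Fin d) ℂ,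
    ψ = WithLp.toLp 2 ((U ⊗ₖ (1 : Matrix (Fin d) (Fin d) ℂ)).mulVec (Gam d))

end LocalSubset

/-!
Every effect of an LOCC measurement has a positive semidefinite partial transpose, and this survives
limits. Let `w` be the vector of entries of a unitary matrix `U` of size `N`, an unnormalised
maximally entangled vector. The partial transpose `F` of `|w⟩⟨w|` is a twisted swap, hence a
Hermitian involution. Partial transposition preserves `Tr (M N)` and `Tr M`, so an effect `M` with
positive partial transpose satisfies `⟨w, M w⟩ = Tr (M^Γ F) ≤ Tr M^Γ = Tr M`. A product of `k`
maximally entangled states is `d ^ (-k / 2) w` for such a `w` with `N = d ^ k`, so the effect `M_T`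
detects `ρ_T` with probability at most `d ^ (-k) Tr M_T`. The effects add up to the identity, whose
trace is `d ^ (2 k)`: the success probabilities add up to at most `d ^ k`, whereas identification
would make their sum the number of `k`-element subsets.
-/

namespace LocalSubset

open Matrix
open scoped ComplexOrder

section PartialTranspose

variable {A A' B B' R : Type*}

/-- The partial transpose of a matrix on a tensor product, with respect to the second factor. -/
def partialTranspose (M : Matrix (A × B) (A' × B') R) : Matrix (A × B') (A' × B) R :=
  of fun p q => M (p.1, q.2) (q.1, p.2)

@[simp]
theorem partialTranspose_apply (M : Matrix (A × B) (A' × B') R) (p : A × B') (q : A' × B) :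
    partialTranspose M p q = M (p.1, q.2) (q.1, p.2) :=
  rfl

theorem partialTranspose_kronecker [Mul R] (K : Matrix A A' R) (L : Matrix B B' R) :
    partialTranspose (K ⊗ₖ L) = K ⊗ₖ Lᵀ :=
  rfl

theorem partialTranspose_one [DecidableEq A] [DecidableEq B] [MulZeroOneClass R] :
    partialTranspose (1 : Matrix (A × B) (A × B) R) = 1 := by
  rw [← one_kronecker_one, partialTranspose_kronecker, transpose_one]

theorem partialTranspose_sum [AddCommMonoid R] {X : Type*} (s : Finset X)
    (M : X → Matrix (A × B) (A' × B') R) :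
    partialTranspose (∑ x ∈ s, M x) = ∑ x ∈ s, partialTranspose (M x) := by
  ext p q
  simp only [partialTranspose_apply, Matrix.sum_apply]

theorem conjTranspose_partialTranspose [Star R] (M : Matrix (A × B) (A' × B') R) :
    (partialTranspose M)ᴴ = partialTranspose Mᴴ :=
  rfl

theorem trace_partialTranspose [AddCommMonoid R] [Fintype A] [Fintype B]
    (M : Matrix (A × B) (A × B) R) : (partialTranspose M).trace = M.trace :=
  rfl

theorem trace_partialTranspose_mul_partialTranspose [NonUnitalNonAssocSemiring R]
    [Fintype A] [Fintype A'] [Fintype B] [Fintype B']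
    (M : Matrix (A × B) (A' × B') R) (N : Matrix (A' × B') (A × B) R) :
    (partialTranspose M * partialTranspose N).trace = (M * N).trace := by
  simp only [Matrix.trace, diag_apply, Matrix.mul_apply, Fintype.sum_prod_type,
    partialTranspose_apply]
  refine Finset.sum_congr rfl fun a _ => ?_
  calc ∑ b', ∑ a', ∑ b, M (a, b) (a', b') * N (a', b') (a, b)
      = ∑ b', ∑ b, ∑ a', M (a, b) (a', b') * N (a', b') (a, b) :=
        Finset.sum_congr rfl fun _ _ => Finset.sum_comm
    _ = ∑ b, ∑ b', ∑ a', M (a, b) (a', b') * N (a', b') (a, b) := Finset.sum_comm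
    _ = ∑ b, ∑ a', ∑ b', M (a, b) (a', b') * N (a', b') (a, b) :=
        Finset.sum_congr rfl fun _ _ => Finset.sum_comm

section Conjugation

variable [CommSemiring R] [StarRing R]

theorem partialTranspose_conj_kronecker_one [Fintype A'] [Fintype B] [DecidableEq B]
    (K : Matrix A' A R) (M : Matrix (A' × B) (A' × B) R) :
    partialTranspose ((K ⊗ₖ (1 : Matrix B B R))ᴴ * M * (K ⊗ₖ (1 : Matrix B B R))) =
      (K ⊗ₖ (1 : Matrix B B R))ᴴ * partialTranspose M * (K ⊗ₖ (1 : Matrix B B R)) := by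
  ext ⟨a, b⟩ ⟨a', b'⟩
  simp [Matrix.mul_apply, Fintype.sum_prod_type, one_apply, apply_ite]

theorem partialTranspose_conj_one_kronecker [Fintype A] [Fintype B'] [DecidableEq A]
    (K : Matrix B' B R) (M : Matrix (A × B') (A × B') R) :
    partialTranspose (((1 : Matrix A A R) ⊗ₖ K)ᴴ * M * ((1 : Matrix A A R) ⊗ₖ K)) =
      ((1 : Matrix A A R) ⊗ₖ K.map star)ᴴ * partialTranspose M *
        ((1 : Matrix A A R) ⊗ₖ K.map star) := by
  ext ⟨a, b⟩ ⟨a', b'⟩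
  simp only [partialTranspose_apply, Matrix.mul_apply, Fintype.sum_prod_type, one_apply,
    conjTranspose_apply, kronecker_apply, map_apply]
  simp only [ite_mul, one_mul, zero_mul, apply_ite star, star_zero, star_star, Finset.sum_mul,
    mul_ite, mul_zero, Finset.sum_ite_irrel, Finset.sum_const_zero, Finset.sum_ite_eq',
    Finset.mem_univ, if_true]
  rw [Finset.sum_comm]
  exact Finset.sum_congr rfl fun x _ => Finset.sum_congr rfl fun y _ => by ring

end Conjugation

end PartialTranspose

section TwistedSwap

variable {I R : Type*}

theorem partialTranspose_vecMulVec_vec [Mul R] {J A B : Type*} (U : Matrix I J R)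
    (V : Matrix A B R) :
    partialTranspose (vecMulVec (vec U) (vec V)) = (Uᵀ ⊗ₖ V).submatrix id Prod.swap :=
  rfl

variable [Fintype I] [DecidableEq I]

theorem partialTranspose_vecMulVec_vec_mul_self [CommRing R] [StarRing R] {U : Matrix I I R}
    (hU : U ∈ unitaryGroup I R) :
    partialTranspose (vecMulVec (vec U) (star (vec U))) *
      partialTranspose (vecMulVec (vec U) (star (vec U))) = 1 := by
  have hUt : Uᵀ * star Uᵀ = 1 :=
    mem_unitaryGroup_iff.1 (transpose_mem_unitaryGroup_iff.2 hU)
  have hUt' : star Uᵀ * Uᵀ = 1 :=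
    mem_unitaryGroup_iff'.1 (transpose_mem_unitaryGroup_iff.2 hU)
  have hF : partialTranspose (vecMulVec (vec U) (star (vec U))) =
      (Uᵀ ⊗ₖ star Uᵀ).submatrix id (Equiv.prodComm I I) :=
    partialTranspose_vecMulVec_vec U (U.map star)
  have hF' : (Uᵀ ⊗ₖ star Uᵀ).submatrix id (Equiv.prodComm I I) =
      (star Uᵀ ⊗ₖ Uᵀ).submatrix (Equiv.prodComm I I) id := by
    ext p q
    exact mul_comm _ _
  rw [hF]
  nth_rw 2 [hF']
  rw [submatrix_mul_equiv, ← mul_kronecker_mul, hUt, hUt', one_kronecker_one, submatrix_id_id]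

variable {𝕜 : Type*} [RCLike 𝕜]

theorem trace_mul_le_trace_of_mul_self_eq_one {M F : Matrix I I 𝕜} (hM : M.PosSemidef)
    (hF : F.IsHermitian) (hFF : F * F = 1) : (M * F).trace ≤ M.trace := by
  have hsq : (1 - F) * (1 - F)ᴴ = 2 • (1 - F) := by
    rw [conjTranspose_sub, conjTranspose_one, hF.eq, sub_mul, mul_sub, mul_sub, hFF]
    simp only [Matrix.one_mul, Matrix.mul_one]
    abel
  have htrace : ((1 - F)ᴴ * M * (1 - F)).trace = 2 • (M.trace - (M * F).trace) := by
    rw [Matrix.mul_assoc, Matrix.trace_mul_comm, Matrix.mul_assoc, hsq, Matrix.mul_smul,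
      trace_smul, Matrix.mul_sub, Matrix.mul_one, trace_sub]
  have hpos : 2 * 0 ≤ 2 * (M.trace - (M * F).trace) := by
    rw [mul_zero, two_mul, ← two_nsmul, ← htrace]
    exact (hM.conjTranspose_mul_mul_same (1 - F)).trace_nonneg
  exact sub_nonneg.1 (le_of_mul_le_mul_of_pos_left hpos two_pos)

theorem trace_mul_vecMulVec_vec_le {M : Matrix (I × I) (I × I) 𝕜}
    (hM : (partialTranspose M).PosSemidef) {U : Matrix I I 𝕜} (hU : U ∈ unitaryGroup I 𝕜) :
    (M * vecMulVec (vec U) (star (vec U))).trace ≤ M.trace := by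
  rw [← trace_partialTranspose_mul_partialTranspose, ← trace_partialTranspose M]
  refine trace_mul_le_trace_of_mul_self_eq_one hM ?_ (partialTranspose_vecMulVec_vec_mul_self hU)
  rw [IsHermitian, conjTranspose_partialTranspose, conjTranspose_vecMulVec, star_star]

end TwistedSwap

section PPTResolution

variable {κ A B R : Type*} [Fintype κ] [DecidableEq A] [DecidableEq B]

/-- A resolution of the identity on a tensor product into matrices with positive semidefinite
partial transpose (PPT). This relaxes LOCC measurements to a closed condition; the matrices `M i`
themselves need not be positive. -/
structure IsPPTResolution [CommRing R] [PartialOrder R] [StarRing R]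
    (M : κ → Matrix (A × B) (A × B) R) : Prop where
  posSemidef : ∀ i, (partialTranspose (M i)).PosSemidef
  sum_eq_one : ∑ i, M i = 1

section Ring

variable [CommRing R] [PartialOrder R] [StarRing R] [StarOrderedRing R]

theorem isPPTResolution_ite_eq [DecidableEq κ] (answer : κ) :
    IsPPTResolution fun i => if i = answer then (1 : Matrix (A × B) (A × B) R) else 0 where
  posSemidef i := by
    split_ifs
    · exact partialTranspose_one (A := A) (B := B) (R := R) ▸ PosSemidef.one
    · exact PosSemidef.zero
  sum_eq_one := by simp only [Finset.sum_ite_eq', Finset.mem_univ, if_true]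

variable {X : Type*} [Fintype X]

theorem IsPPTResolution.sum_conj {A' B' : X → Type*} [Finite A] [Finite B]
    [∀ x, Fintype (A' x)] [∀ x, Fintype (B' x)] [∀ x, DecidableEq (A' x)]
    [∀ x, DecidableEq (B' x)] {M : ∀ x, κ → Matrix (A' x × B' x) (A' x × B' x) R}
    (hM : ∀ x, IsPPTResolution (M x)) {L L' : ∀ x, Matrix (A' x × B' x) (A × B) R}
    (hL : ∑ x, (L x)ᴴ * L x = 1)
    (hLL' : ∀ x (N : Matrix (A' x × B' x) (A' x × B' x) R),
      partialTranspose ((L x)ᴴ * N * L x) = (L' x)ᴴ * partialTranspose N * L' x) :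
    IsPPTResolution fun i => ∑ x, (L x)ᴴ * M x i * L x where
  posSemidef i := by
    simp only [partialTranspose_sum, hLL']
    exact posSemidef_sum _ fun x _ => ((hM x).posSemidef i).conjTranspose_mul_mul_same _
  sum_eq_one := by
    rw [Finset.sum_comm]
    simp only [← Matrix.sum_mul, ← Matrix.mul_sum, (hM _).sum_eq_one, Matrix.mul_one, hL]

theorem IsPPTResolution.sum_conj_kronecker_one {A' : X → Type*} [Finite A] [Fintype B]
    [∀ x, Fintype (A' x)] [∀ x, DecidableEq (A' x)] {K : ∀ x, Matrix (A' x) A R}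
    (hK : ∑ x, (K x)ᴴ * K x = 1) {M : ∀ x, κ → Matrix (A' x × B) (A' x × B) R}
    (hM : ∀ x, IsPPTResolution (M x)) :
    IsPPTResolution fun i =>
      ∑ x, (K x ⊗ₖ (1 : Matrix B B R))ᴴ * M x i * (K x ⊗ₖ (1 : Matrix B B R)) := by
  refine IsPPTResolution.sum_conj hM ?_ fun x => partialTranspose_conj_kronecker_one (K x)
  simp only [conjTranspose_kronecker, ← mul_kronecker_mul, conjTranspose_one, Matrix.mul_one]
  calc ∑ x, ((K x)ᴴ * K x) ⊗ₖ (1 : Matrix B B R)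
      = (∑ x, (K x)ᴴ * K x) ⊗ₖ (1 : Matrix B B R) :=
        ((kroneckerBilinear (R := R) (α := R)).map_sum₂ _ _ _).symm
    _ = 1 := by rw [hK, one_kronecker_one]

theorem IsPPTResolution.sum_conj_one_kronecker {B' : X → Type*} [Fintype A] [Finite B]
    [∀ x, Fintype (B' x)] [∀ x, DecidableEq (B' x)] {K : ∀ x, Matrix (B' x) B R}
    (hK : ∑ x, (K x)ᴴ * K x = 1) {M : ∀ x, κ → Matrix (A × B' x) (A × B' x) R}
    (hM : ∀ x, IsPPTResolution (M x)) :
    IsPPTResolution fun i =>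
      ∑ x, ((1 : Matrix A A R) ⊗ₖ K x)ᴴ * M x i * ((1 : Matrix A A R) ⊗ₖ K x) := by
  refine IsPPTResolution.sum_conj hM ?_ fun x => partialTranspose_conj_one_kronecker (K x)
  simp only [conjTranspose_kronecker, ← mul_kronecker_mul, conjTranspose_one, Matrix.mul_one]
  calc ∑ x, (1 : Matrix A A R) ⊗ₖ ((K x)ᴴ * K x)
      = (1 : Matrix A A R) ⊗ₖ ∑ x, (K x)ᴴ * K x :=
        (map_sum (kroneckerBilinear (R := R) (1 : Matrix A A R)) _ _).symm
    _ = 1 := by rw [hK, one_kronecker_one]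

end Ring

variable {𝕜 : Type*} [RCLike 𝕜]

theorem isClosed_setOf_posSemidef {I : Type*} [Finite I] :
    IsClosed {M : Matrix I I 𝕜 | M.PosSemidef} := by
  have := Fintype.ofFinite I
  simp only [posSemidef_iff_dotProduct_mulVec, IsHermitian, Set.ofPred_and, Set.ofPred_forall]
  exact (isClosed_eq (by fun_prop) continuous_id).inter <| isClosed_iInter fun x =>
    isClosed_le continuous_const (by fun_prop)

theorem isClosed_setOf_isPPTResolution [Finite A] [Finite B] :
    IsClosed {M : κ → Matrix (A × B) (A × B) 𝕜 | IsPPTResolution M} := by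
  have hcont (i : κ) :
      Continuous fun M : κ → Matrix (A × B) (A × B) 𝕜 => partialTranspose (M i) :=
    continuous_matrix fun p q => by simp only [partialTranspose_apply]; fun_prop
  have hiff (M : κ → Matrix (A × B) (A × B) 𝕜) :
      IsPPTResolution M ↔ (∀ i, (partialTranspose (M i)).PosSemidef) ∧ ∑ i, M i = 1 :=
    ⟨fun h => ⟨h.posSemidef, h.sum_eq_one⟩, fun h => ⟨h.1, h.2⟩⟩
  simp only [hiff, Set.ofPred_and, Set.ofPred_forall]
  exact (isClosed_iInter fun i => isClosed_setOf_posSemidef.preimage (hcont i)).inter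
    (isClosed_eq (by fun_prop) continuous_const)

end PPTResolution

section LOCC

variable {κ A B : Type} [DecidableEq κ] [Fintype κ] {M : κ → Matrix (A × B) (A × B) ℂ}

theorem IsFiniteLOCC.isPPTResolution [hA : DecidableEq A] [hB : DecidableEq B]
    (h : IsFiniteLOCC M) : IsPPTResolution M := by
  revert hA hB
  induction h with
  | halt answer =>
    intro _ _
    convert isPPTResolution_ite_eq (R := ℂ) answer
  | @alice _ _ _ decA _ decB _ _ K hK M _ ih =>
    intro hA hB
    obtain rfl : hA = decA := Subsingleton.elim _ _
    obtain rfl : hB = decB := Subsingleton.elim _ _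
    exact .sum_conj_kronecker_one hK fun x => ih x
  | @bob _ _ _ decA _ decB _ _ K hK M _ ih =>
    intro hA hB
    obtain rfl : hA = decA := Subsingleton.elim _ _
    obtain rfl : hB = decB := Subsingleton.elim _ _
    exact .sum_conj_one_kronecker hK fun x => ih x

theorem IsLOCC.isPPTResolution [Finite A] [Finite B] [DecidableEq A] [DecidableEq B]
    (h : IsLOCC M) : IsPPTResolution M :=
  closure_minimal (fun _ hN => hN.isPPTResolution) isClosed_setOf_isPPTResolution h

end LOCC

section PiKronecker

variable {J R : Type*} [Fintype J] {l m n : J → Type*}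

/-- The Kronecker product of a finite family of matrices, indexed by dependent functions. It
describes products of several states, each of which is given by a matrix. -/
def piKronecker [CommMonoid R] (U : ∀ j, Matrix (l j) (m j) R) :
    Matrix (∀ j, l j) (∀ j, m j) R :=
  of fun a b => ∏ j, U j (a j) (b j)

theorem piKronecker_mul [CommSemiring R] [DecidableEq J] [∀ j, Fintype (m j)]
    (U : ∀ j, Matrix (l j) (m j) R) (V : ∀ j, Matrix (m j) (n j) R) :
    piKronecker U * piKronecker V = piKronecker fun j => U j * V j := by
  ext a b
  simp only [piKronecker, Matrix.mul_apply, of_apply, ← Finset.prod_mul_distrib,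
    Fintype.prod_sum]

theorem conjTranspose_piKronecker [CommSemiring R] [StarRing R] (U : ∀ j, Matrix (l j) (m j) R) :
    (piKronecker U)ᴴ = piKronecker fun j => (U j)ᴴ := by
  ext a b
  simp only [piKronecker, conjTranspose_apply, of_apply, star_prod]

theorem piKronecker_one [CommSemiring R] [∀ j, DecidableEq (m j)] :
    piKronecker (fun j => (1 : Matrix (m j) (m j) R)) = 1 := by
  ext a b
  simp only [piKronecker, of_apply, one_apply, Fintype.prod_ite_zero, funext_iff,
    Finset.prod_const_one]

theorem piKronecker_mem_unitaryGroup [CommRing R] [StarRing R] [DecidableEq J]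
    [∀ j, Fintype (m j)] [∀ j, DecidableEq (m j)] {U : ∀ j, Matrix (m j) (m j) R}
    (hU : ∀ j, U j ∈ unitaryGroup (m j) R) : piKronecker U ∈ unitaryGroup (∀ j, m j) R := by
  have hU' (j : J) : U j * (U j)ᴴ = 1 := mem_unitaryGroup_iff.1 (hU j)
  rw [mem_unitaryGroup_iff, star_eq_conjTranspose, conjTranspose_piKronecker, piKronecker_mul]
  simp only [hU', piKronecker_one]

end PiKronecker

section MaximallyEntangled

variable {ι : Type} {d k : ℕ}

theorem Gam_eq_smul_vec_one (d : ℕ) : Gam d = ((√d : ℝ) : ℂ)⁻¹ • vec 1 := by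
  ext p
  simp [Gam, vec, one_apply, eq_comm]

theorem IsMaximallyEntangled.exists_eq_smul_vec {ψ : EuclideanSpace ℂ (Fin d × Fin d)}
    (h : IsMaximallyEntangled ψ) :
    ∃ U ∈ unitaryGroup (Fin d) ℂ, ψ = WithLp.toLp 2 (((√d : ℝ) : ℂ)⁻¹ • vec U) := by
  obtain ⟨U, hU, rfl⟩ := h
  refine ⟨Uᵀ, transpose_mem_unitaryGroup_iff.2 hU, ?_⟩
  rw [Gam_eq_smul_vec_one, mulVec_smul, kronecker_mulVec_vec, Matrix.one_mul, Matrix.one_mul]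

theorem tupleState_eq_smul_vec_piKronecker {A B : Type} {ψ : ι → EuclideanSpace ℂ (A × B)}
    {c : ℂ} {U : ι → Matrix B A ℂ} (hψ : ∀ l, ψ l = WithLp.toLp 2 (c • vec (U l)))
    (f : Fin k → ι) : tupleState ψ f = c ^ k • vec (piKronecker fun j => U (f j)) := by
  ext p
  simp only [tupleState, hψ, Pi.smul_apply, vec, piKronecker, of_apply, smul_eq_mul,
    Finset.prod_mul_distrib, Finset.prod_const, Finset.card_univ, Fintype.card_fin]

theorem trace_mul_vecMulVec_tupleState_le {ψ : ι → EuclideanSpace ℂ (Fin d × Fin d)}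
    (hψ : ∀ l, IsMaximallyEntangled (ψ l))
    {M : Matrix ((Fin k → Fin d) × (Fin k → Fin d)) ((Fin k → Fin d) × (Fin k → Fin d)) ℂ}
    (hM : (partialTranspose M).PosSemidef) (f : Fin k → ι) :
    (M * vecMulVec (tupleState ψ f) (star (tupleState ψ f))).trace ≤ ((d : ℂ) ^ k)⁻¹ * M.trace := by
  choose U hU hψU using fun l => (hψ l).exists_eq_smul_vec
  have hnorm : ((√d : ℝ) : ℂ)⁻¹ ^ k * star (((√d : ℝ) : ℂ)⁻¹ ^ k) = ((d : ℂ) ^ k)⁻¹ := by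
    rw [star_pow, ← mul_pow, star_inv₀, Complex.star_def, Complex.conj_ofReal, ← mul_inv,
      ← Complex.ofReal_mul, Real.mul_self_sqrt (Nat.cast_nonneg d), Complex.ofReal_natCast, inv_pow]
  rw [tupleState_eq_smul_vec_piKronecker hψU, star_smul, smul_vecMulVec, vecMulVec_smul, smul_smul,
    hnorm, Matrix.mul_smul, trace_smul, smul_eq_mul]
  have hW : piKronecker (fun j => U (f j)) ∈ unitaryGroup (Fin k → Fin d) ℂ :=
    piKronecker_mem_unitaryGroup fun j => hU (f j)
  gcongr
  exact trace_mul_vecMulVec_vec_le hM hW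

variable [DecidableEq ι]

theorem trace_mul_subsetState_le {A B : Type} [Fintype A] [Fintype B]
    {ψ : ι → EuclideanSpace ℂ (A × B)}
    {M : Matrix ((Fin k → A) × (Fin k → B)) ((Fin k → A) × (Fin k → B)) ℂ} {c : ℂ}
    (hc : ∀ f, (M * vecMulVec (tupleState ψ f) (star (tupleState ψ f))).trace ≤ c)
    (T : {T : Finset ι // T.card = k}) : (M * subsetState ψ T).trace ≤ c := by
  have hcard : Fintype.card (Fin k ≃ {i // i ∈ T.1}) = k.factorial := by
    rw [Fintype.card_equiv (Fintype.equivOfCardEq (by simp [T.2])), Fintype.card_fin]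
  rw [subsetState, Matrix.mul_smul, trace_smul, Finset.mul_sum, trace_sum, smul_eq_mul]
  calc (k.factorial : ℂ)⁻¹ * ∑ σ : Fin k ≃ {i // i ∈ T.1},
        (M * vecMulVec (tupleState ψ fun j => (σ j).1)
          (star (tupleState ψ fun j => (σ j).1))).trace
      ≤ (k.factorial : ℂ)⁻¹ * ∑ _σ : Fin k ≃ {i // i ∈ T.1}, c := by
        gcongr with σ
        exact hc _
    _ = c := by
        rw [Finset.sum_const, Finset.card_univ, hcard, nsmul_eq_mul,
          inv_mul_cancel_left₀ (Nat.cast_ne_zero.2 k.factorial_ne_zero)]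

theorem IsPPTResolution.sum_trace_mul_subsetState_le [Fintype ι]
    {ψ : ι → EuclideanSpace ℂ (Fin d × Fin d)} (hψ : ∀ l, IsMaximallyEntangled (ψ l))
    {M : {T : Finset ι // T.card = k} →
      Matrix ((Fin k → Fin d) × (Fin k → Fin d)) ((Fin k → Fin d) × (Fin k → Fin d)) ℂ}
    (hM : IsPPTResolution M) : ∑ T, (M T * subsetState ψ T).trace ≤ (d : ℂ) ^ k :=
  calc ∑ T, (M T * subsetState ψ T).trace
      ≤ ∑ T, ((d : ℂ) ^ k)⁻¹ * (M T).trace :=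
        Finset.sum_le_sum fun T _ =>
          trace_mul_subsetState_le (trace_mul_vecMulVec_tupleState_le hψ (hM.posSemidef T)) T
    _ = ((d : ℂ) ^ k)⁻¹ * (∑ T, M T).trace := by rw [trace_sum, Finset.mul_sum]
    _ = ((d : ℂ) ^ k)⁻¹ * ((d : ℂ) ^ k * (d : ℂ) ^ k) := by
        simp [hM.sum_eq_one, trace_one]
    _ = (d : ℂ) ^ k := by rw [← mul_assoc, inv_mul_mul_self]

end MaximallyEntangled

end LocalSubset

theorem mainTheorem2_general {ι : Type} [DecidableEq ι] [Fintype ι] {d k : ℕ}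
    {ψ : ι → EuclideanSpace ℂ (Fin d × Fin d)}
    (hψ : ∀ l, LocalSubset.IsMaximallyEntangled (ψ l)) (h : d ^ k < (Fintype.card ι).choose k) :
    LocalSubset.IsLocallyUnidentifiable ψ k := by
  open scoped ComplexOrder in
  rintro ⟨M, hLOCC, hsuccess⟩
  have hsum := hLOCC.isPPTResolution.sum_trace_mul_subsetState_le hψ
  have hchoose : (((Fintype.card ι).choose k : ℕ) : ℂ) ≤ ((d ^ k : ℕ) : ℂ) := by
    simpa [hsuccess] using hsum
  exact h.not_ge (Nat.cast_le.1 hchoose)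

theorem mainTheorem2 (d k : ℕ) :
    (∀ b : OrthonormalBasis (Fin (d ^ 2)) ℂ (EuclideanSpace ℂ (Fin d × Fin d)),
      (∀ l, LocalSubset.IsMaximallyEntangled (b l)) →
      d ^ k < (d ^ 2).choose k →
      LocalSubset.IsLocallyUnidentifiable (fun l => b l) k) ∧
    (∀ (D : ℕ) (ψ : Fin D → EuclideanSpace ℂ (Fin d × Fin d)),
      Orthonormal ℂ ψ →
      (∀ l, LocalSubset.IsMaximallyEntangled (ψ l)) →
      d ^ k < D.choose k →
      LocalSubset.IsLocallyUnidentifiable ψ k) := by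
  exact ⟨fun b hb h => mainTheorem2_general hb (by rwa [Fintype.card_fin]),
    fun D ψ _ hψ h => mainTheorem2_general hψ (by rwa [Fintype.card_fin])⟩
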